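/- All rings are commutative with nonzero identity, and ring extensions are unital. Let $R\subseteq T$ be a ring extension, where $R$ is von Neumann regular (for every $a\in R$ there is $x\in R$ with $a=axa$). Call $T$ a minimal ring extension of $R$ if $R\neq T$ and there is no ring $S$ with $R\subsetneq S\subsetneq T$; call a field extension $K\subseteq L$ minimal if $K\ne L$ and there is no field strictly between $K$ and $L$; and let $(R:T)=\{s\in T : sT\subseteq R\}$ be the conductor. Then $T$ is a minimal ring extension of $R$ if and only if there exists a maximal ideal $\mathfrak m$ of $R$ such that one of the following three conditions holds: (i) $\mathfrak m$ is a maximal ideal of $T$ and $T/\mathfrak m$ is a minimal field extension of $R/\mathfrak m$; (ii) there exists $q\in T\setminus R$ such that $T=R[q]$, $q^2-q\in\mathfrak m$, and $\mathfrak m q\subseteq R$; (iii) there exists $q\in T\setminus R$ such that $T=R[q]$, $q^2\in R$, $q^3\in R$, and $\mathfrak m q\subseteq R$. If any of these three conditions holds for a maximal ideal $\mathfrak m$ of $R$, then $\mathfrak m=(R:T)$; in particular $\mathfrak m$ is uniquely determined. Moreover, conditions (i)–(iii) are mutually exclusive. -/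

import Mathlib

namespace MinExt

/-- A commutative ring is von Neumann regular if every `a` can be written as `a * x * a`. -/
def IsVonNeumannRegular (R : Type*) [CommRing R] : Prop :=
  ∀ a : R, ∃ x : R, a = a * x * a

/-- `T` is a minimal ring extension of `R`: `R` embeds in `T` as a proper subring, and there is no
subring strictly between (the image of) `R` and `T`. -/
def IsMinimalRingExtension (R T : Type*) [CommRing R] [CommRing T] [Algebra R T] : Prop :=
  Function.Injective (algebraMap R T) ∧ IsCoatom (algebraMap R T).range

/-- `f : K → L` is a minimal field extension: `K` and `L` are fields, `f` is not onto, and no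
subfield of `L` lies strictly between the image of `K` and `L`. -/
def IsMinimalFieldExtension {K L : Type*} [CommRing K] [CommRing L] (f : K →+* L) : Prop :=
  IsField K ∧ IsField L ∧ f.range ≠ ⊤ ∧
    ∀ S : Subring L, IsField S → f.range ≤ S → S = f.range ∨ S = ⊤

/-- The conductor `(R : T) = {s ∈ T | s T ⊆ R}`, an ideal of `T`. -/
def conductor (R T : Type*) [CommRing R] [CommRing T] [Algebra R T] : Ideal T where
  carrier := {s | ∀ t : T, s * t ∈ (algebraMap R T).range}
  add_mem' := fun ha hb t => by
    rw [add_mul]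
    exact add_mem (ha t) (hb t)
  zero_mem' := fun t => by
    rw [zero_mul]
    exact zero_mem _
  smul_mem' := fun c x hx t => by
    have h : c • x * t = x * (c * t) := by
      rw [smul_eq_mul]
      ring
    rw [h]
    exact hx (c * t)

section Cases

variable (R T : Type*) [CommRing R] [CommRing T] [Algebra R T] (m : Ideal R)

theorem le_comap_of_coe_eq_image {R T : Type*} [CommRing R] [CommRing T] [Algebra R T]
    {m : Ideal R} {M : Ideal T} (h : (M : Set T) = algebraMap R T '' (m : Set R)) :
    m ≤ M.comap (algebraMap R T) := fun a ha => by
  rw [Ideal.mem_comap, ← SetLike.mem_coe, h]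
  exact ⟨a, ha, rfl⟩

/-- The subset `m` of `T` is a maximal ideal of `T`, and the canonical map `R/m → T/m` is a minimal
field extension. -/
def CaseField : Prop :=
  ∃ (M : Ideal T) (h : (M : Set T) = algebraMap R T '' (m : Set R)),
    M.IsMaximal ∧
      IsMinimalFieldExtension (Ideal.quotientMap M (algebraMap R T) (le_comap_of_coe_eq_image h))

/-- There is `q ∈ T \ R` with `T = R[q]`, `q² - q ∈ m` and `m q ⊆ R`. -/
def CaseIdempotent : Prop :=
  ∃ q : T, q ∉ (algebraMap R T).range ∧ Algebra.adjoin R {q} = ⊤ ∧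
    q ^ 2 - q ∈ algebraMap R T '' (m : Set R) ∧
    ∀ a ∈ m, algebraMap R T a * q ∈ (algebraMap R T).range

/-- There is `q ∈ T \ R` with `T = R[q]`, `q² ∈ R`, `q³ ∈ R` and `m q ⊆ R`. -/
def CaseNilpotent : Prop :=
  ∃ q : T, q ∉ (algebraMap R T).range ∧ Algebra.adjoin R {q} = ⊤ ∧
    q ^ 2 ∈ (algebraMap R T).range ∧ q ^ 3 ∈ (algebraMap R T).range ∧
    ∀ a ∈ m, algebraMap R T a * q ∈ (algebraMap R T).range

end Cases

end MinExt

/-! Let `C` be the conductor. If `R` is a maximal subring and `J` an ideal of `T`, then `R + J` is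
`R` or `T`. For `J = eT` with `e` an idempotent of `R`, this puts `e` or `1 - e` in `C`. In a von
Neumann regular ring every principal ideal is generated by an idempotent, so `C` is maximal in `R`
(`isMaximal_comap_conductor`). If `C` is also maximal in `T`, case (i) holds. Otherwise an element
`t` of a larger proper ideal yields a nilpotent or an idempotent modulo `C` that lies outside `R`
(`cases_of_isCoatom`). Conversely, in (ii) and (iii) `T = R + Rq` and `T/R` is one-dimensional over
`R/m`; case (i) reduces to the quotient fields, where `subalgebra_eq_bot_or_eq_top` passes from
intermediate fields to intermediate rings. -/

namespace MinExt

/-! ### Minimal field extensions and their intermediate rings. -/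

section FieldExtensions

variable {K L : Type*} [Field K] [Field L] [Algebra K L]

open Polynomial in
/-- A transcendental element does not belong to the field generated by its square. -/
theorem notMem_adjoin_sq_of_transcendental {x : L} (hx : Transcendental K x) :
    x ∉ IntermediateField.adjoin K {x ^ 2} := by
  rw [IntermediateField.mem_adjoin_simple_iff]
  rintro ⟨r, s, h⟩
  have hx0 : x ≠ 0 := by
    rintro rfl
    exact hx isAlgebraic_zero
  have hs : aeval (x ^ 2) s ≠ 0 := by
    intro h0
    rw [h0, div_zero] at h
    exact hx0 h
  rw [eq_div_iff hs] at h
  have hpoly : X * expand K 2 s = expand K 2 r := by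
    apply transcendental_iff_injective.mp hx
    simpa [expand_aeval] using h
  have hs0 : s ≠ 0 := by
    rintro rfl
    simp at hs
  -- The left side has odd degree, the right side even degree.
  have hdeg := congrArg natDegree hpoly
  rw [natDegree_X_mul ((expand_ne_zero two_pos).mpr hs0), natDegree_expand, natDegree_expand]
    at hdeg
  omega

/-- If a field extension has no proper intermediate fields, then it has no proper intermediate
rings either. -/
theorem subalgebra_eq_bot_or_eq_top
    (h : ∀ F : IntermediateField K L, F = ⊥ ∨ F = ⊤) (A : Subalgebra K L) : A = ⊥ ∨ A = ⊤ := by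
  have key : ∀ x : L, x ∉ (⊥ : IntermediateField K L) →
      IntermediateField.adjoin K {x} = ⊤ := fun x hx =>
    (h _).resolve_left fun h0 => hx (h0 ▸ IntermediateField.mem_adjoin_simple_self K x)
  by_cases hA : A ≤ ⊥
  · exact Or.inl (le_bot_iff.mp hA)
  right
  obtain ⟨x, hxA, hx⟩ := SetLike.not_le_iff_exists.mp hA
  have hx' : x ∉ (⊥ : IntermediateField K L) := by
    rwa [IntermediateField.mem_bot, ← Algebra.mem_bot]
  -- Algebraicity makes `K[x]` the field `K(x)`. For transcendental `x`, `K(x ^ 2)` would be a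
  -- proper intermediate field.
  have hxalg : IsAlgebraic K x := by
    by_contra htr
    have hsq : x ^ 2 ∉ (⊥ : IntermediateField K L) := by
      rw [IntermediateField.mem_bot]
      rintro ⟨a, ha⟩
      exact htr (IsAlgebraic.of_pow two_pos (ha ▸ isAlgebraic_algebraMap a))
    exact notMem_adjoin_sq_of_transcendental htr (key _ hsq ▸ IntermediateField.mem_top)
  have htop := congrArg IntermediateField.toSubalgebra (key x hx')
  rw [IntermediateField.adjoin_simple_toSubalgebra_of_isAlgebraic hxalg,
    IntermediateField.top_toSubalgebra] at htop
  rw [eq_top_iff, ← htop, Algebra.adjoin_le_iff, Set.singleton_subset_iff]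
  exact hxA

end FieldExtensions

/-- In a minimal field extension every intermediate ring is trivial. -/
theorem IsMinimalFieldExtension.subring_eq {K L : Type*} [CommRing K] [CommRing L] {f : K →+* L}
    (h : IsMinimalFieldExtension f) {S : Subring L} (hS : f.range ≤ S) :
    S = f.range ∨ S = ⊤ := by
  obtain ⟨hK, hL, -, hmin⟩ := h
  let := hK.toField
  let := hL.toField
  let := f.toAlgebra
  have hF : ∀ F : IntermediateField K L, F = ⊥ ∨ F = ⊤ := by
    intro F
    have hle : f.range ≤ F.toSubfield.toSubring := by
      rintro _ ⟨a, rfl⟩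
      exact F.algebraMap_mem a
    rcases hmin F.toSubfield.toSubring (Field.toIsField F) hle with h1 | h1
    · left
      ext x
      rw [IntermediateField.mem_bot]
      exact SetLike.ext_iff.mp h1 x
    · right
      ext x
      exact ⟨fun _ => IntermediateField.mem_top, fun _ => (SetLike.ext_iff.mp h1 x).mpr trivial⟩
  let A : Subalgebra K L := { S with algebraMap_mem' := fun a => hS ⟨a, rfl⟩ }
  rcases subalgebra_eq_bot_or_eq_top hF A with h1 | h1
  · left
    ext x
    exact (SetLike.ext_iff.mp h1 x).trans Algebra.mem_bot
  · right
    ext x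
    exact ⟨fun _ => trivial, fun _ => (SetLike.ext_iff.mp h1 x).mpr Algebra.mem_top⟩

/-! ### The three cases give maximal subrings with conductor `m`. -/

section Conductor

variable {R T : Type*} [CommRing R] [CommRing T] [Algebra R T] {m : Ideal R}

/-- If `m` is maximal and both `m` and some `r ∉ m` multiply `t` into a subring `S` containing `R`,
then `t ∈ S`. -/
theorem mem_subring_of_mul_mem (hm : m.IsMaximal) {S : Subring T} (hS : (algebraMap R T).range ≤ S)
    {t : T} (ht : ∀ a ∈ m, algebraMap R T a * t ∈ S) {r : R} (hr : r ∉ m)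
    (hrt : algebraMap R T r * t ∈ S) : t ∈ S := by
  obtain ⟨b, a, ha, hab⟩ := hm.exists_inv hr
  have h : t = algebraMap R T b * (algebraMap R T r * t) + algebraMap R T a * t := by
    rw [← mul_assoc, ← add_mul, ← map_mul, ← map_add, hab, map_one, one_mul]
  rw [h]
  exact S.add_mem (S.mul_mem (hS ⟨b, rfl⟩) hrt) (ht a ha)

theorem mem_range_of_mem_conductor {c : T} (hc : c ∈ conductor R T) :
    c ∈ (algebraMap R T).range := by
  simpa using hc 1

/-- A maximal ideal that multiplies `T` into `R ≠ T` is the conductor. -/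
theorem image_eq_conductor (hm : m.IsMaximal) (hne : (algebraMap R T).range ≠ ⊤)
    (h : ∀ a ∈ m, ∀ t : T, algebraMap R T a * t ∈ (algebraMap R T).range) :
    algebraMap R T '' (m : Set R) = (conductor R T : Set T) := by
  ext c
  constructor
  · rintro ⟨a, ha, rfl⟩
    exact h a ha
  · intro hc
    obtain ⟨r, rfl⟩ := mem_range_of_mem_conductor hc
    refine ⟨r, ?_, rfl⟩
    by_contra hr
    refine hne (eq_top_iff.mpr fun t _ => ?_)
    exact mem_subring_of_mul_mem hm le_rfl (fun a ha => h a ha t) hr (hc t)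

/-- If `q ^ 2 ∈ R + R q` and `q` generates `T`, then `T = R + R q`. -/
theorem exists_eq_add_mul {q : T} (hq : Algebra.adjoin R {q} = ⊤) {c d : R}
    (hsq : q ^ 2 = algebraMap R T c + algebraMap R T d * q) (t : T) :
    ∃ a b : R, t = algebraMap R T a + algebraMap R T b * q := by
  have ht : t ∈ Algebra.adjoin R {q} := hq ▸ Algebra.mem_top
  induction ht using Algebra.adjoin_induction with
  | mem x hx =>
    rw [Set.mem_singleton_iff] at hx
    exact ⟨0, 1, by simp [hx]⟩
  | algebraMap r => exact ⟨r, 0, by simp⟩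
  | add x y _ _ hx hy =>
    obtain ⟨a, b, rfl⟩ := hx
    obtain ⟨a', b', rfl⟩ := hy
    exact ⟨a + a', b + b', by simp only [map_add]; ring⟩
  | mul x y _ _ hx hy =>
    obtain ⟨a, b, rfl⟩ := hx
    obtain ⟨a', b', rfl⟩ := hy
    refine ⟨a * a' + b * b' * c, a * b' + b * a' + b * b' * d, ?_⟩
    simp only [map_add, map_mul]
    linear_combination algebraMap R T b * algebraMap R T b' * hsq

theorem range_ne_top_of_notMem {q : T} (hq : q ∉ (algebraMap R T).range) :
    (algebraMap R T).range ≠ ⊤ := fun h => hq (h ▸ Subring.mem_top q)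

theorem mul_mem_range_of_eq_add_mul {q : T}
    (hT : ∀ t : T, ∃ a b : R, t = algebraMap R T a + algebraMap R T b * q)
    (hmq : ∀ a ∈ m, algebraMap R T a * q ∈ (algebraMap R T).range) :
    ∀ a ∈ m, ∀ t : T, algebraMap R T a * t ∈ (algebraMap R T).range := by
  intro a ha t
  obtain ⟨c, d, rfl⟩ := hT t
  rw [mul_add, mul_left_comm]
  exact add_mem (mul_mem ⟨a, rfl⟩ ⟨c, rfl⟩) (mul_mem ⟨d, rfl⟩ (hmq a ha))

/-- If `T = R + R q` and `m q ⊆ R` for a maximal ideal `m`, then there is no ring strictly between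
`R` and `T`. -/
theorem isCoatom_range_of_eq_add_mul (hm : m.IsMaximal) {q : T}
    (hq : q ∉ (algebraMap R T).range)
    (hT : ∀ t : T, ∃ a b : R, t = algebraMap R T a + algebraMap R T b * q)
    (hmq : ∀ a ∈ m, algebraMap R T a * q ∈ (algebraMap R T).range) :
    IsCoatom (algebraMap R T).range := by
  refine ⟨range_ne_top_of_notMem hq, fun S hS => ?_⟩
  obtain ⟨hle, s, hsS, hs⟩ := SetLike.lt_iff_le_and_exists.mp hS
  obtain ⟨a, b, rfl⟩ := hT s
  have hbq : algebraMap R T b * q ∈ S := by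
    simpa using S.sub_mem hsS (hle ⟨a, rfl⟩)
  have hb : b ∉ m := fun hb => hs (add_mem ⟨a, rfl⟩ (hmq b hb))
  have hqS : q ∈ S := mem_subring_of_mul_mem hm hle (fun a ha => hle (hmq a ha)) hb hbq
  refine eq_top_iff.mpr fun t _ => ?_
  obtain ⟨c, d, rfl⟩ := hT t
  exact S.add_mem (hle ⟨c, rfl⟩) (S.mul_mem (hle ⟨d, rfl⟩) hqS)

theorem CaseField.mul_mem_range (h : CaseField R T m) :
    ∀ a ∈ m, ∀ t : T, algebraMap R T a * t ∈ (algebraMap R T).range := by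
  obtain ⟨M, hM, -⟩ := h
  intro a ha t
  have haM : algebraMap R T a ∈ M := le_comap_of_coe_eq_image hM ha
  have hat : algebraMap R T a * t ∈ (M : Set T) := M.mul_mem_right t haM
  rw [hM] at hat
  obtain ⟨b, -, hb⟩ := hat
  exact ⟨b, hb⟩

theorem CaseField.range_ne_top (h : CaseField R T m) : (algebraMap R T).range ≠ ⊤ := by
  obtain ⟨M, hM, -, -, -, hne, -⟩ := h
  refine fun htop => hne (eq_top_iff.mpr fun x _ => ?_)
  obtain ⟨t, rfl⟩ := Ideal.Quotient.mk_surjective x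
  obtain ⟨r, rfl⟩ : t ∈ (algebraMap R T).range := htop ▸ Subring.mem_top t
  exact ⟨Ideal.Quotient.mk m r, Ideal.quotientMap_mk⟩

/-- Since `M` lies inside the image of `R`, rings between `R` and `T` correspond to rings between
`R/m` and `T/M`. -/
theorem CaseField.isCoatom_range (h : CaseField R T m) : IsCoatom (algebraMap R T).range := by
  refine ⟨h.range_ne_top, fun S hS => ?_⟩
  obtain ⟨M, hM, -, hmin⟩ := h
  obtain ⟨hle, s, hsS, hs⟩ := SetLike.lt_iff_le_and_exists.mp hS
  have hMR : ∀ x ∈ M, x ∈ (algebraMap R T).range := by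
    intro x hx
    have hx' : x ∈ (M : Set T) := hx
    rw [hM] at hx'
    obtain ⟨b, -, hb⟩ := hx'
    exact ⟨b, hb⟩
  have hle' : (Ideal.quotientMap M (algebraMap R T) (le_comap_of_coe_eq_image hM)).range ≤
      S.map (Ideal.Quotient.mk M) := by
    rintro _ ⟨x, rfl⟩
    obtain ⟨r, rfl⟩ := Ideal.Quotient.mk_surjective x
    rw [Ideal.quotientMap_mk]
    exact ⟨_, hle ⟨r, rfl⟩, rfl⟩
  rcases hmin.subring_eq hle' with h1 | h1
  · exfalso
    have hsm : Ideal.Quotient.mk M s ∈ S.map (Ideal.Quotient.mk M) := ⟨s, hsS, rfl⟩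
    rw [h1] at hsm
    obtain ⟨x, hx⟩ := hsm
    obtain ⟨r, rfl⟩ := Ideal.Quotient.mk_surjective x
    rw [Ideal.quotientMap_mk, eq_comm, Ideal.Quotient.eq] at hx
    refine hs ?_
    simpa using add_mem (hMR _ hx) (⟨r, rfl⟩ : algebraMap R T r ∈ (algebraMap R T).range)
  · refine eq_top_iff.mpr fun t _ => ?_
    obtain ⟨s', hs', hst⟩ : Ideal.Quotient.mk M t ∈ S.map (Ideal.Quotient.mk M) :=
      h1 ▸ Subring.mem_top _
    rw [eq_comm, Ideal.Quotient.eq] at hst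
    simpa using S.add_mem (hle (hMR _ hst)) hs'

theorem CaseIdempotent.exists_generator (h : CaseIdempotent R T m) :
    ∃ q : T, q ∉ (algebraMap R T).range ∧
      (∀ t : T, ∃ a b : R, t = algebraMap R T a + algebraMap R T b * q) ∧
      (∀ a ∈ m, algebraMap R T a * q ∈ (algebraMap R T).range) ∧
      q ^ 2 - q ∈ algebraMap R T '' (m : Set R) := by
  obtain ⟨q, hq, hgen, hsq, hmq⟩ := h
  refine ⟨q, hq, ?_, hmq, hsq⟩
  obtain ⟨c, -, hc⟩ := hsq
  refine exists_eq_add_mul hgen (c := c) (d := 1) ?_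
  rw [hc, map_one]
  ring

/-- The gain is `q ^ 2 ∈ m`: otherwise `q ^ 2` is a unit modulo `m`, and `q ^ 2 * q = q ^ 3 ∈ R`
would force `q ∈ R`. -/
theorem CaseNilpotent.exists_generator (hm : m.IsMaximal) (h : CaseNilpotent R T m) :
    ∃ q : T, q ∉ (algebraMap R T).range ∧
      (∀ t : T, ∃ a b : R, t = algebraMap R T a + algebraMap R T b * q) ∧
      (∀ a ∈ m, algebraMap R T a * q ∈ (algebraMap R T).range) ∧
      q ^ 2 ∈ algebraMap R T '' (m : Set R) := by
  obtain ⟨q, hq, hgen, ⟨c, hc⟩, hcube, hmq⟩ := h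
  refine ⟨q, hq, ?_, hmq, c, ?_, hc⟩
  · exact exists_eq_add_mul hgen (c := c) (d := 0) (by rw [hc, map_zero]; ring)
  · by_contra hcm
    refine hq (mem_subring_of_mul_mem hm le_rfl hmq hcm ?_)
    rwa [hc, ← pow_succ]

/-- In each of the three cases, `R` is a maximal subring of `T`. -/
theorem isCoatom_range_of_cases (hm : m.IsMaximal)
    (h : CaseField R T m ∨ CaseIdempotent R T m ∨ CaseNilpotent R T m) :
    IsCoatom (algebraMap R T).range := by
  rcases h with h | h | h
  · exact h.isCoatom_range
  · obtain ⟨q, hq, hT, hmq, -⟩ := h.exists_generator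
    exact isCoatom_range_of_eq_add_mul hm hq hT hmq
  · obtain ⟨q, hq, hT, hmq, -⟩ := h.exists_generator hm
    exact isCoatom_range_of_eq_add_mul hm hq hT hmq

/-- In each of the three cases, the ideal in question is the conductor. -/
theorem image_eq_conductor_of_cases (hm : m.IsMaximal)
    (h : CaseField R T m ∨ CaseIdempotent R T m ∨ CaseNilpotent R T m) :
    algebraMap R T '' (m : Set R) = (conductor R T : Set T) := by
  rcases h with h | h | h
  · exact image_eq_conductor hm h.range_ne_top h.mul_mem_range
  · obtain ⟨q, hq, hT, hmq, -⟩ := h.exists_generator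
    exact image_eq_conductor hm (range_ne_top_of_notMem hq) (mul_mem_range_of_eq_add_mul hT hmq)
  · obtain ⟨q, hq, hT, hmq, -⟩ := h.exists_generator hm
    exact image_eq_conductor hm (range_ne_top_of_notMem hq) (mul_mem_range_of_eq_add_mul hT hmq)

/-! ### Mutual exclusivity. -/

theorem CaseField.isMaximal_conductor (hm : m.IsMaximal) (h : CaseField R T m) :
    (conductor R T).IsMaximal := by
  have hC := image_eq_conductor_of_cases hm (Or.inl h)
  obtain ⟨M, hM, hmax, -⟩ := h
  rwa [← SetLike.coe_injective (hM.trans hC)]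

theorem CaseField.not_caseIdempotent (hm : m.IsMaximal) (h : CaseField R T m) :
    ¬ CaseIdempotent R T m := by
  intro h'
  have hmax := h.isMaximal_conductor hm
  have hC := image_eq_conductor_of_cases hm (Or.inl h)
  obtain ⟨q, hq, -, -, hsq⟩ := h'.exists_generator
  rw [hC, SetLike.mem_coe, show q ^ 2 - q = q * (q - 1) by ring] at hsq
  rcases hmax.isPrime.mem_or_mem hsq with h1 | h1
  · exact hq (mem_range_of_mem_conductor h1)
  · exact hq (by simpa using add_mem (mem_range_of_mem_conductor h1) (one_mem _))

theorem CaseField.not_caseNilpotent (hm : m.IsMaximal) (h : CaseField R T m) :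
    ¬ CaseNilpotent R T m := by
  intro h'
  have hmax := h.isMaximal_conductor hm
  have hC := image_eq_conductor_of_cases hm (Or.inl h)
  obtain ⟨q, hq, -, -, hsq⟩ := h'.exists_generator hm
  rw [hC] at hsq
  exact hq (mem_range_of_mem_conductor (hmax.isPrime.mem_of_pow_mem 2 hsq))

theorem CaseIdempotent.not_caseNilpotent (hRT : Function.Injective (algebraMap R T))
    (hm : m.IsMaximal) (h : CaseIdempotent R T m) : ¬ CaseNilpotent R T m := by
  intro h'
  have hC := image_eq_conductor_of_cases hm (Or.inr (Or.inl h))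
  obtain ⟨p, hp, -, hmp, hpsq⟩ := h.exists_generator
  obtain ⟨q, hq, hT, hmq, hqsq⟩ := h'.exists_generator hm
  obtain ⟨a, b, hab⟩ := hT p
  rw [hC, SetLike.mem_coe] at hpsq hqsq
  -- With `p = a + b q`, this is `(p - a) ^ 2 - (p ^ 2 - p)`, where `(p - a) ^ 2 = b ^ 2 q ^ 2`. As
  -- `p ∉ R`, it forces `1 - 2 a ∈ m`, then `a ∈ m`, hence `1 ∈ m`.
  have hmem : algebraMap R T (1 - 2 * a) * p + algebraMap R T (a ^ 2) ∈ conductor R T := by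
    have := sub_mem ((conductor R T).mul_mem_left (algebraMap R T (b ^ 2)) hqsq) hpsq
    convert this using 1
    simp only [map_sub, map_mul, map_pow, map_one, map_ofNat]
    linear_combination (p - algebraMap R T a + algebraMap R T b * q) * hab
  have hunit : 1 - 2 * a ∈ m := by
    by_contra hna
    refine hp (mem_subring_of_mul_mem hm le_rfl hmp hna ?_)
    simpa using sub_mem (mem_range_of_mem_conductor hmem)
      (⟨a ^ 2, rfl⟩ : algebraMap R T (a ^ 2) ∈ (algebraMap R T).range)
  have hunit' : algebraMap R T (1 - 2 * a) ∈ conductor R T := by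
    rw [← SetLike.mem_coe, ← hC]
    exact ⟨_, hunit, rfl⟩
  have hasq : algebraMap R T (a ^ 2) ∈ (conductor R T : Set T) := by
    simpa using sub_mem hmem ((conductor R T).mul_mem_right p hunit')
  rw [← hC] at hasq
  have ha : a ∈ m := hm.isPrime.mem_of_pow_mem 2 ((hRT.mem_set_image).mp hasq)
  refine hm.ne_top ((Ideal.eq_top_iff_one m).mpr ?_)
  simpa using add_mem hunit (m.mul_mem_left 2 ha)

/-! ### From a maximal subring to the three cases. -/

/-- The subring `R + J` of `T`, for an ideal `J` of `T`. -/
def rangeAddIdeal (R : Type*) {T : Type*} [CommRing R] [CommRing T] [Algebra R T] (J : Ideal T) :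
    Subring T :=
  ((Ideal.Quotient.mk J).comp (algebraMap R T)).range.comap (Ideal.Quotient.mk J)

theorem mem_rangeAddIdeal {J : Ideal T} {t : T} :
    t ∈ rangeAddIdeal R J ↔ ∃ r : R, t - algebraMap R T r ∈ J := by
  simp only [rangeAddIdeal, Subring.mem_comap, RingHom.mem_range, RingHom.comp_apply]
  exact exists_congr fun r => by rw [eq_comm, Ideal.Quotient.eq]

theorem range_le_rangeAddIdeal (J : Ideal T) : (algebraMap R T).range ≤ rangeAddIdeal R J := by
  rintro _ ⟨r, rfl⟩
  exact mem_rangeAddIdeal.mpr ⟨r, by simp⟩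

theorem le_rangeAddIdeal (J : Ideal T) {t : T} (ht : t ∈ J) : t ∈ rangeAddIdeal R J :=
  mem_rangeAddIdeal.mpr ⟨0, by simpa using ht⟩

/-- If `R` is a maximal subring of `T`, then an ideal of `T` is contained in `R` or is a supplement
of `R`. -/
theorem ideal_subset_range_or_rangeAddIdeal_eq_top (h : IsCoatom (algebraMap R T).range)
    (J : Ideal T) : (∀ t ∈ J, t ∈ (algebraMap R T).range) ∨ rangeAddIdeal R J = ⊤ := by
  rcases h.le_iff.mp (range_le_rangeAddIdeal J) with h1 | h1
  · exact Or.inr h1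
  · exact Or.inl fun t ht => h1 ▸ le_rangeAddIdeal J ht

/-- For a maximal subring `R`, the conductor contains `e` or `1 - e` for every idempotent `e` of
`R`. -/
theorem mem_conductor_or_one_sub_mem_conductor (h : IsCoatom (algebraMap R T).range) {e : R}
    (he : IsIdempotentElem e) :
    algebraMap R T e ∈ conductor R T ∨ algebraMap R T (1 - e) ∈ conductor R T := by
  rcases ideal_subset_range_or_rangeAddIdeal_eq_top h (Ideal.span {algebraMap R T e}) with h1 | h1
  · exact Or.inl fun t => h1 _ (Ideal.mem_span_singleton.mpr ⟨t, rfl⟩)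
  · right
    intro t
    obtain ⟨r, hr⟩ := mem_rangeAddIdeal.mp (h1 ▸ Subring.mem_top t)
    obtain ⟨u, hu⟩ := Ideal.mem_span_singleton.mp hr
    -- Multiplying `t = r + e u` by `1 - e` kills `e u`.
    refine ⟨(1 - e) * r, ?_⟩
    have he' : algebraMap R T e * algebraMap R T e = algebraMap R T e := by
      rw [← map_mul, he.eq]
    simp only [map_sub, map_mul, map_one]
    linear_combination (algebraMap R T e - 1) * hu + u * he'

/-- The conductor of a maximal subring that is von Neumann regular is a maximal ideal of it. -/
theorem isMaximal_comap_conductor (hR : IsVonNeumannRegular R)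
    (h : IsCoatom (algebraMap R T).range) :
    ((conductor R T).comap (algebraMap R T)).IsMaximal := by
  rw [Ideal.isMaximal_iff]
  constructor
  · intro h1
    rw [Ideal.mem_comap, map_one] at h1
    exact h.1 (eq_top_iff.mpr fun t _ => by simpa using h1 t)
  · intro J a hle ha haJ
    obtain ⟨x, hx⟩ := hR a
    have he : IsIdempotentElem (a * x) := by
      rw [IsIdempotentElem, ← mul_assoc, ← hx]
    rcases mem_conductor_or_one_sub_mem_conductor h he with h1 | h1
    · refine absurd ?_ ha
      rw [hx, Ideal.mem_comap, map_mul]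
      exact Ideal.mul_mem_right _ _ h1
    · simpa using add_mem (hle h1) (J.mul_mem_right x haJ)

theorem image_comap_conductor :
    algebraMap R T '' ((conductor R T).comap (algebraMap R T) : Set R) = conductor R T := by
  rw [Ideal.coe_comap, Set.image_preimage_eq_iff]
  exact fun c hc => mem_range_of_mem_conductor hc

theorem caseField_of_isMaximal (hm : ((conductor R T).comap (algebraMap R T)).IsMaximal)
    (h : IsCoatom (algebraMap R T).range) (hC : (conductor R T).IsMaximal) :
    CaseField R T ((conductor R T).comap (algebraMap R T)) := by
  refine ⟨conductor R T, image_comap_conductor.symm, hC,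
    (Ideal.Quotient.maximal_ideal_iff_isField_quotient _).mp hm,
    (Ideal.Quotient.maximal_ideal_iff_isField_quotient _).mp hC, ?_, ?_⟩
  · refine fun htop => h.1 (eq_top_iff.mpr fun t _ => ?_)
    obtain ⟨x, hx⟩ : Ideal.Quotient.mk (conductor R T) t ∈ RingHom.range _ :=
      htop ▸ Subring.mem_top _
    obtain ⟨r, rfl⟩ := Ideal.Quotient.mk_surjective x
    rw [Ideal.quotientMap_mk, eq_comm, Ideal.Quotient.eq] at hx
    simpa using add_mem (mem_range_of_mem_conductor hx)
      (⟨r, rfl⟩ : algebraMap R T r ∈ (algebraMap R T).range)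
  · intro S _ hS
    have hle : (algebraMap R T).range ≤ S.comap (Ideal.Quotient.mk (conductor R T)) := by
      rintro _ ⟨r, rfl⟩
      exact hS ⟨Ideal.Quotient.mk _ r, Ideal.quotientMap_mk⟩
    rcases h.le_iff.mp hle with h1 | h1
    · right
      refine eq_top_iff.mpr fun x _ => ?_
      obtain ⟨t, rfl⟩ := Ideal.Quotient.mk_surjective x
      exact (SetLike.ext_iff.mp h1 t).mpr trivial
    · left
      refine le_antisymm (fun x hx => ?_) hS
      obtain ⟨t, rfl⟩ := Ideal.Quotient.mk_surjective x
      obtain ⟨r, rfl⟩ := (SetLike.ext_iff.mp h1 t).mp hx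
      exact ⟨Ideal.Quotient.mk _ r, Ideal.quotientMap_mk⟩

theorem adjoin_eq_top_of_notMem (h : IsCoatom (algebraMap R T).range) {q : T}
    (hq : q ∉ (algebraMap R T).range) : Algebra.adjoin R {q} = ⊤ := by
  have hle : (algebraMap R T).range ≤ (Algebra.adjoin R {q}).toSubring := by
    rintro _ ⟨r, rfl⟩
    exact Subalgebra.algebraMap_mem _ r
  rcases h.le_iff.mp hle with h1 | h1
  · exact eq_top_iff.mpr fun t _ => (SetLike.ext_iff.mp h1 t).mpr trivial
  · exact absurd ((SetLike.ext_iff.mp h1 q).mp (Algebra.self_mem_adjoin_singleton R q)) hq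

/-- A proper ideal of `T` containing the conductor meets `R` in the conductor, if the latter is
maximal in `R`. -/
theorem mem_conductor_of_mem_ideal (hm : ((conductor R T).comap (algebraMap R T)).IsMaximal)
    {J : Ideal T} (hCJ : conductor R T ≤ J) (hJ : J ≠ ⊤) {t : T} (ht : t ∈ J)
    (htR : t ∈ (algebraMap R T).range) : t ∈ conductor R T := by
  obtain ⟨r, rfl⟩ := htR
  -- `J` contracts to a proper ideal of `R` containing a maximal one.
  have := hm.eq_of_le (Ideal.comap_ne_top (algebraMap R T) hJ) (Ideal.comap_mono hCJ)
  rw [← Ideal.mem_comap, this]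
  exact ht

/-- Among the proper ideals of `T` strictly containing the conductor there are no strict
inclusions, if `R` is a maximal subring with maximal conductor. -/
theorem ideal_le_of_conductor_lt (hm : ((conductor R T).comap (algebraMap R T)).IsMaximal)
    (h : IsCoatom (algebraMap R T).range) {I J : Ideal T} (hCI : conductor R T < I)
    (hIJ : I ≤ J) (hJ : J ≠ ⊤) : J ≤ I := by
  intro t ht
  have hI : I ≠ ⊤ := ne_top_of_le_ne_top hJ hIJ
  rcases ideal_subset_range_or_rangeAddIdeal_eq_top h I with h1 | h1
  · exact absurd (fun x hx => mem_conductor_of_mem_ideal hm hCI.le hI hx (h1 x hx)) hCI.not_ge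
  -- Modular law: `T = R + I` gives `J = (R ∩ J) + I`, and `R ∩ J` lies in the conductor, hence in
  -- `I`.
  · obtain ⟨r, hr⟩ := mem_rangeAddIdeal.mp (h1 ▸ Subring.mem_top t)
    have hrJ : algebraMap R T r ∈ J := by simpa using sub_mem ht (hIJ hr)
    have hrC := mem_conductor_of_mem_ideal hm (hCI.le.trans hIJ) hJ hrJ ⟨r, rfl⟩
    simpa using add_mem hr (hCI.le hrC)

/-- A maximal subring whose conductor is maximal in it falls under one of the three cases. -/
theorem cases_of_isCoatom (hm : ((conductor R T).comap (algebraMap R T)).IsMaximal)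
    (h : IsCoatom (algebraMap R T).range) :
    CaseField R T ((conductor R T).comap (algebraMap R T)) ∨
      CaseIdempotent R T ((conductor R T).comap (algebraMap R T)) ∨
      CaseNilpotent R T ((conductor R T).comap (algebraMap R T)) := by
  by_cases hC : (conductor R T).IsMaximal
  · exact Or.inl (caseField_of_isMaximal hm h hC)
  right
  have hCtop : conductor R T ≠ ⊤ := by
    intro htop
    exact hm.ne_top (by rw [htop, Ideal.comap_top])
  obtain ⟨J, hJmax, hCJ⟩ := Ideal.exists_le_maximal _ hCtop
  have hlt : conductor R T < J := lt_of_le_of_ne hCJ fun h0 => hC (h0 ▸ hJmax)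
  obtain ⟨-, t, htJ, htC⟩ := SetLike.lt_iff_le_and_exists.mp hlt
  by_cases hsq : t ^ 2 ∈ conductor R T
  · right
    have htR : t ∉ (algebraMap R T).range := fun htR =>
      htC (mem_conductor_of_mem_ideal hm hCJ hJmax.ne_top htJ htR)
    refine ⟨t, htR, adjoin_eq_top_of_notMem h htR, mem_range_of_mem_conductor hsq, ?_,
      fun a ha => ha t⟩
    rw [pow_succ]
    exact hsq t
  · left
    have hI : conductor R T < conductor R T ⊔ Ideal.span {t ^ 2} := by
      refine lt_of_le_of_ne le_sup_left fun h0 => hsq ?_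
      rw [h0]
      exact Ideal.mem_sup_right (Ideal.mem_span_singleton_self _)
    have hIJ : conductor R T ⊔ Ideal.span {t ^ 2} ≤ J :=
      sup_le hCJ ((Ideal.span_singleton_le_iff_mem J).mpr (J.pow_mem_of_mem htJ 2 two_pos))
    -- No ideal fits strictly between, so `t = c + t ^ 2 u` with `c` in the conductor; thus `t u` is
    -- idempotent modulo it.
    obtain ⟨c, hc, y, hy, hcy⟩ :=
      Submodule.mem_sup.mp (ideal_le_of_conductor_lt hm h hI hIJ hJmax.ne_top htJ)
    obtain ⟨u, rfl⟩ := Ideal.mem_span_singleton.mp hy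
    have hqR : t * u ∉ (algebraMap R T).range := by
      intro hqR
      have hqC := mem_conductor_of_mem_ideal hm hCJ hJmax.ne_top (J.mul_mem_right u htJ) hqR
      refine htC ?_
      rw [← hcy, show t ^ 2 * u = t * (t * u) by ring]
      exact add_mem hc (Ideal.mul_mem_left _ t hqC)
    refine ⟨t * u, hqR, adjoin_eq_top_of_notMem h hqR, ?_, fun a ha => ha (t * u)⟩
    rw [image_comap_conductor, SetLike.mem_coe,
      show (t * u) ^ 2 - t * u = (-u) * c by linear_combination u * hcy]
    exact Ideal.mul_mem_left _ _ hc

end Conductor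

end MinExt

theorem theorem2p2 {R T : Type*} [CommRing R] [CommRing T] [Algebra R T]
    (hRT : Function.Injective (algebraMap R T)) (hR : MinExt.IsVonNeumannRegular R) :
    (MinExt.IsMinimalRingExtension R T ↔
      ∃ m : Ideal R, m.IsMaximal ∧
        (MinExt.CaseField R T m ∨ MinExt.CaseIdempotent R T m ∨ MinExt.CaseNilpotent R T m)) ∧
    (∀ m : Ideal R, m.IsMaximal →
      (MinExt.CaseField R T m ∨ MinExt.CaseIdempotent R T m ∨ MinExt.CaseNilpotent R T m) →
        algebraMap R T '' (m : Set R) = (MinExt.conductor R T : Set T)) ∧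
    (∀ m : Ideal R, m.IsMaximal →
      ¬ (MinExt.CaseField R T m ∧ MinExt.CaseIdempotent R T m) ∧
      ¬ (MinExt.CaseField R T m ∧ MinExt.CaseNilpotent R T m) ∧
      ¬ (MinExt.CaseIdempotent R T m ∧ MinExt.CaseNilpotent R T m)) := by
  refine ⟨⟨fun h => ?_, fun ⟨m, hm, h⟩ => ⟨hRT, MinExt.isCoatom_range_of_cases hm h⟩⟩,
    fun m hm h => MinExt.image_eq_conductor_of_cases hm h, fun m hm =>
    ⟨fun h => h.1.not_caseIdempotent hm h.2, fun h => h.1.not_caseNilpotent hm h.2,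
      fun h => h.1.not_caseNilpotent hRT hm h.2⟩⟩
  have hm := MinExt.isMaximal_comap_conductor hR h.2
  exact ⟨_, hm, MinExt.cases_of_isCoatom hm h.2⟩
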